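/- A hypergraph $\mathbb H$ is a set $V$ of vertices with a set $E$ of hyperedges, which are subsets of $V$; it is $3$-uniform if each hyperedge has exactly three elements. A cycle of length $n\ge 2$ is a sequence $v_1,e_1,v_2,\dots,v_n,e_n,v_1$ with pairwise distinct vertices $v_i$, pairwise distinct hyperedges $e_i$, $v_i\in e_{i-1}\cap e_i$ for $2\le i\le n$ and $v_1\in e_1\cap e_n$. The girth is the length of a shortest cycle, and $\infty$ if there is no cycle; a hyperforest is a hypergraph of girth $\infty$. A vertex is isolated if it lies in no hyperedge. Let $\mathbb 2$ be the set $\{a,1\}$ with the ternary relation $R=\{(a,1,1),(1,a,1),(1,1,a)\}$. A homomorphism $\mathbb H\to\mathbb 2$ is a map $\varphi:V\to\{a,1\}$ with $(\varphi(u),\varphi(v),\varphi(w))\in R$ whenever $\{u,v,w\}\in E$. We call $\mathbb H$ *$\le 2$-robustly 1-in-3 satisfiable* if for all distinct $u,v\in V$ every function $f:\{u,v\}\to\{a,1\}$ extends to a homomorphism $\mathbb H\to\mathbb 2$, except when $\{u,v\}$ is contained in a hyperedge and $f(u)=f(v)=a$. All algebras have signature $\{+,\cdot,\uparrow,\mathbin{\text{©}},!,\exp_2,0,1\}$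 ($+,\cdot,\uparrow,\mathbin{\text{©}}$ binary, $!,\exp_2$ unary, $0,1$ constants). The algebra $\mathbf B$ has universe $\{0,1,2,a,\infty\}$ and operations ($x\uparrow y$ has its base $x$ in the row) $$\begin{array}{c|ccccc}+&0&1&2&a&\infty\\\hline 0&0&1&2&a&\infty\\1&1&2&2&\infty&\infty\\2&2&2&2&\infty&\infty\\a&a&\infty&\infty&a&\infty\\\infty&\infty&\infty&\infty&\infty&\infty\end{array}\qquad \begin{array}{c|ccccc}\cdot&0&1&2&a&\infty\\\hline 0&0&0&0&0&0\\1&0&1&2&a&\infty\\2&0&2&2&a&\infty\\a&0&a&a&\infty&\infty\\\infty&0&\infty&\infty&\infty&\infty\end{array}\qquad \begin{array}{c|ccccc}\uparrow&0&1&2&a&\infty\\\hline 0&1&0&0&0&0\\1&1&1&1&1&1\\2&1&2&2&\infty&\infty\\a&1&a&\infty&\infty&\infty\\\infty&1&\infty&\infty&\infty&\infty\end{array}$$ together with $\exp_2(x)=1+x$; $x!=x\cdot x$ for $x\ne0$ and $0!=1$; $x\mathbin{\text{©}} y=x+y+1$ if $0\notin\{x,y\}$, and $x\mathbin{\text{©}}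 y=1$ otherwise. For a $3$-uniform $\mathbb H$ of girth at least $5$, the *hypergraph semiring* $S_{\mathbb H}$ is the multiplicatively commutative semiring generated by elements $\mathbf a_v$ ($v\in V$) and a multiplicatively absorbing element $\infty$, subject to: (1) $x+x=x$, and $x+y=\infty$ for $x\neq y$; (2) $\mathbf a_u\mathbf a_v=\mathbf a_v\mathbf a_u$; (3) $\mathbf a_u\mathbf a_v=\infty$ if $\{u,v\}$ is not a $2$-element subset of a hyperedge; (4) $\mathbf a_{u_1}\mathbf a_{v_1}\mathbf a_{w_1}=\mathbf a_{u_2}\mathbf a_{v_2}\mathbf a_{w_2}$ whenever $\{u_1,v_1,w_1\},\{u_2,v_2,w_2\}\in E$; (5) $\mathbf a_{u_1}\mathbf a_{v_1}=\mathbf a_{u_2}\mathbf a_{v_2}$ whenever $\{u_1,v_1,w\},\{u_2,v_2,w\}\in E$ for some vertex $w$. That is, its multiplicative semigroup is presented by these generators, the absorption laws for $\infty$ and relations (2)–(5), and its addition is given by (1). The *extended hypergraph algebra* $\mathbf B_{\mathbb H}$ has universe the disjoint union $\{\mathbf 0,\mathbf 1,\mathbf 2\}\cup S_{\mathbb H}$,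 with constants $\mathbf 0,\mathbf 1$. On $\{\mathbf 0,\mathbf 1,\mathbf 2\}$ the operations $+,\cdot,\uparrow$ are as in $\mathbf B$; on $S_{\mathbb H}$ the operations $+,\cdot$ are those of $S_{\mathbb H}$ and $b\uparrow b'=\infty$; and for $b\in S_{\mathbb H}$: $\mathbf 0+b=b+\mathbf 0=b$, $\mathbf i+b=b+\mathbf i=\infty$ for $\mathbf i\in\{\mathbf 1,\mathbf 2\}$, $\mathbf 0\cdot b=b\cdot\mathbf 0=\mathbf 0$, $\mathbf i\cdot b=b\cdot\mathbf i=b$ for $\mathbf i\in\{\mathbf 1,\mathbf 2\}$, $\mathbf 0\uparrow b=\mathbf 0$, $\mathbf 1\uparrow b=\mathbf 1$, $\mathbf 2\uparrow b=\infty$, $b\uparrow\mathbf 0=\mathbf 1$, $b\uparrow\mathbf 1=b$, $b\uparrow\mathbf 2=\infty$. Finally $\exp_2(x)=\mathbf 1+x$; $x!=x\cdot x$ for $x\neq\mathbf 0$ and $\mathbf 0!=\mathbf 1$; $x\mathbin{\text{©}} y=x+y+\mathbf 1$ if $\mathbf 0\notin\{x,y\}$, and $x\mathbin{\text{©}} y=\mathbf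 1$ otherwise. **Lemma.** Let $\mathbb H$ be a $3$-uniform hypergraph. 1. If $\mathbb H$ has girth at least $5$ and no isolated vertices, and is $\le 2$-robustly 1-in-3 satisfiable, then $\mathbf B_{\mathbb H}$ lies in the variety of $\mathbf B$; that is, every equation in the signature above that holds in $\mathbf B$ holds in $\mathbf B_{\mathbb H}$. 2. If $\mathbb H$ is a hyperforest, then $\mathbb H$ is $\le 2$-robustly 1-in-3 satisfiable. -/

import Mathlib

/-! ## The signature, and membership in a variety -/

/-- Operation symbols of the signature `{+, ·, ↑, ©, !, exp₂, 0, 1}`, sorted by arity. -/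
inductive CombOp : ℕ → Type
  | zero : CombOp 0
  | one : CombOp 0
  | factorial : CombOp 1
  | exp2 : CombOp 1
  | add : CombOp 2
  | mul : CombOp 2
  | pow : CombOp 2
  | binom : CombOp 2

/-- The algebraic signature `{+, ·, ↑, ©, !, exp₂, 0, 1}` (no relation symbols). -/
def combLang : FirstOrder.Language.{0, 0} := ⟨CombOp, fun _ => Empty⟩

/-- `N` lies in the variety generated by `M`: every equation `s ≈ t` (in finitely many of countably
many variables) that is valid in `M` is valid in `N`. -/
def InVarietyOf (L : FirstOrder.Language) (M N : Type*) [L.Structure M] [L.Structure N] : Prop :=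
  ∀ s t : L.Term ℕ,
    (∀ x : ℕ → M, s.realize x = t.realize x) → ∀ y : ℕ → N, s.realize y = t.realize y

/-! ## The five-element algebra `𝐁` -/

/-- The universe `{0, 1, 2, a, ∞}` of `𝐁`. -/
inductive AlgB
  | zero | one | two | a | infty
  deriving DecidableEq

namespace AlgB

/-- Addition of `𝐁`. -/
def add : AlgB → AlgB → AlgB
  | zero, y => y
  | x, zero => x
  | infty, _ => infty
  | _, infty => infty
  | a, a => a
  | a, _ => infty
  | _, a => infty
  | one, one => two
  | one, two => two
  | two, one => two
  | two, two => two

/-- Multiplication of `𝐁`. -/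
def mul : AlgB → AlgB → AlgB
  | zero, _ => zero
  | _, zero => zero
  | one, y => y
  | x, one => x
  | two, y => y
  | x, two => x
  | _, _ => infty

/-- Exponentiation `x ↑ y` of `𝐁` (first argument the base). -/
def pow : AlgB → AlgB → AlgB
  | _, zero => one
  | zero, _ => zero
  | one, _ => one
  | x, one => x
  | two, two => two
  | _, _ => infty

/-- The operation `©` of `𝐁`. -/
def binom : AlgB → AlgB → AlgB
  | zero, _ => one
  | _, zero => one
  | one, one => two
  | one, two => two
  | two, one => two
  | two, two => two
  | _, _ => infty

/-- The operation `!` of `𝐁`. -/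
def factorial : AlgB → AlgB
  | zero => one
  | one => one
  | two => two
  | a => infty
  | infty => infty

/-- The operation `exp₂` of `𝐁`. -/
def exp2 : AlgB → AlgB
  | zero => one
  | one => two
  | two => two
  | a => infty
  | infty => infty

/-- Interpretation of the operation symbols in `𝐁`. -/
def interp : {n : ℕ} → CombOp n → (Fin n → AlgB) → AlgB
  | _, .zero, _ => zero
  | _, .one, _ => one
  | _, .factorial, x => factorial (x 0)
  | _, .exp2, x => exp2 (x 0)
  | _, .add, x => add (x 0) (x 1)
  | _, .mul, x => mul (x 0) (x 1)
  | _, .pow, x => pow (x 0) (x 1)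
  | _, .binom, x => binom (x 0) (x 1)

instance instStructure : combLang.Structure AlgB where
  funMap := fun f x => interp f x
  RelMap := fun r _ => Empty.elim r

end AlgB

/-! ## Hypergraphs -/

namespace Hypergraph

variable {α : Type*}

/-- Every hyperedge has exactly three points. -/
def IsThreeUniform (H : Hypergraph α) : Prop := ∀ e ∈ H.edgeSet, e.ncard = 3

/-- `{u, v, w}` is a hyperedge. -/
def IsTriple (H : Hypergraph α) (u v w : H.vertexSet) : Prop :=
  ({(u : α), (v : α), (w : α)} : Set α) ∈ H.edgeSet

/-- `{u, v}` is a 2-element subset of a hyperedge. -/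
def IsPair (H : Hypergraph α) (u v : H.vertexSet) : Prop :=
  u ≠ v ∧ H.Adj u v

/-- There is a cycle `v₀, e₀, v₁, e₁, …, v_{n-1}, e_{n-1}, v₀` of length `n ≥ 2`, with pairwise
distinct vertices and pairwise distinct hyperedges, where consecutive vertices (cyclically) both lie
in the hyperedge between them. -/
def HasCycle (H : Hypergraph α) (n : ℕ) : Prop :=
  2 ≤ n ∧ ∃ (v : Fin n → α) (e : Fin n → Set α),
    Function.Injective v ∧ Function.Injective e ∧ (∀ i, e i ∈ H.edgeSet) ∧
    ∀ i j : Fin n, (j : ℕ) = ((i : ℕ) + 1) % n → v i ∈ e i ∧ v j ∈ e i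

/-- The length of a shortest cycle, and `⊤` if there is no cycle. -/
noncomputable def girth (H : Hypergraph α) : ℕ∞ :=
  ⨅ (n : ℕ) (_ : H.HasCycle n), (n : ℕ∞)

/-- A hyperforest is a hypergraph of infinite girth. -/
def IsHyperforest (H : Hypergraph α) : Prop := H.girth = ⊤

end Hypergraph

/-! ## The template of positive 1-in-3-SAT, and robust satisfiability -/

/-- The universe `{a, 1}` of the template `𝟚`. -/
inductive Tmpl
  | a | one
  deriving DecidableEq

/-- The ternary relation `{(a,1,1), (1,a,1), (1,1,a)}` of the template. -/
def Tmpl.rel : Set (Tmpl × Tmpl × Tmpl) := {(a, one, one), (one, a, one), (one, one, a)}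

namespace Hypergraph

variable {α : Type*}

/-- `φ` is a homomorphism from `H`, seen as a structure with one symmetric ternary relation, to the
template. -/
def IsTmplHom (H : Hypergraph α) (φ : H.vertexSet → Tmpl) : Prop :=
  ∀ u v w : H.vertexSet, H.IsTriple u v w → (φ u, φ v, φ w) ∈ Tmpl.rel

/-- `H` is `≤ 2`-robustly 1-in-3 satisfiable: each assignment `u ↦ p`, `v ↦ q` on two distinct
vertices extends to a homomorphism into the template, except when `{u, v}` is contained in a
hyperedge and `p = q = a`. -/
def IsRobustlySat (H : Hypergraph α) : Prop :=
  ∀ u v : H.vertexSet, u ≠ v → ∀ p q : Tmpl, ¬ (H.IsPair u v ∧ p = .a ∧ q = .a) →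
    ∃ φ : H.vertexSet → Tmpl, H.IsTmplHom φ ∧ φ u = p ∧ φ v = q

/-! ## The hypergraph semiring -/

/-- Words over the generators: `some v` stands for `𝐚_v` and `none` stands for `∞`. -/
abbrev Word (H : Hypergraph α) : Type _ := FreeSemigroup (Option H.vertexSet)

/-- The generator `𝐚_v`, as a word. -/
def letter (H : Hypergraph α) (v : H.vertexSet) : H.Word := FreeSemigroup.of (some v)

/-- The generator `∞`, as a word. -/
def inftyWord (H : Hypergraph α) : H.Word := FreeSemigroup.of none

/-- The multiplicative defining relations of the hypergraph semiring. -/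
inductive SemiringRel (H : Hypergraph α) : H.Word → H.Word → Prop
  | infty_mul (x : Option H.vertexSet) :
      SemiringRel H (H.inftyWord * FreeSemigroup.of x) H.inftyWord
  | mul_infty (x : Option H.vertexSet) :
      SemiringRel H (FreeSemigroup.of x * H.inftyWord) H.inftyWord
  | comm (u v : H.vertexSet) :
      SemiringRel H (H.letter u * H.letter v) (H.letter v * H.letter u)
  | not_pair (u v : H.vertexSet) : ¬ H.IsPair u v →
      SemiringRel H (H.letter u * H.letter v) H.inftyWord
  | triple (u₁ v₁ w₁ u₂ v₂ w₂ : H.vertexSet) : H.IsTriple u₁ v₁ w₁ → H.IsTriple u₂ v₂ w₂ →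
      SemiringRel H (H.letter u₁ * H.letter v₁ * H.letter w₁)
        (H.letter u₂ * H.letter v₂ * H.letter w₂)
  | pair (u₁ v₁ u₂ v₂ w : H.vertexSet) : H.IsTriple u₁ v₁ w → H.IsTriple u₂ v₂ w →
      SemiringRel H (H.letter u₁ * H.letter v₁) (H.letter u₂ * H.letter v₂)

/-- The hypergraph semiring `S_H`. Its addition is prescribed outright: `x + x = x`, and `x + y = ∞`
for `x ≠ y`. So every element is a product of generators, and `S_H` is presented, as a
multiplicative semigroup in which `∞` is absorbing, by the relations above. -/
def HypSemiring (H : Hypergraph α) : Type _ := (conGen H.SemiringRel).Quotient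

namespace HypSemiring

variable {H : Hypergraph α}

/-- The element of `S_H` that a word represents. -/
def mk (w : H.Word) : H.HypSemiring := (w : (conGen H.SemiringRel).Quotient)

/-- The element `∞` of `S_H`. -/
def infty : H.HypSemiring := mk H.inftyWord

/-- Multiplication of `S_H`, induced by concatenation of words. -/
def mul : H.HypSemiring → H.HypSemiring → H.HypSemiring :=
  fun (x y : (conGen H.SemiringRel).Quotient) => x * y

open Classical in
/-- Addition of `S_H`. -/
noncomputable def add (x y : H.HypSemiring) : H.HypSemiring := if x = y then x else infty

end HypSemiring

/-! ## The extended hypergraph algebra `𝐁_H` -/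

/-- The universe `{𝟎, 𝟏, 𝟐} ∪ S_H` (a disjoint union) of `𝐁_H`. -/
inductive AlgBH (H : Hypergraph α)
  | zero | one | two
  | of (s : H.HypSemiring)

namespace AlgBH

variable {H : Hypergraph α}

/-- The element `∞` of `𝐁_H`. -/
def infty : H.AlgBH := of HypSemiring.infty

/-- Addition of `𝐁_H`. -/
noncomputable def add : H.AlgBH → H.AlgBH → H.AlgBH
  | zero, y => y
  | x, zero => x
  | of s, of t => of (s.add t)
  | of _, _ => infty
  | _, of _ => infty
  | one, one => two
  | one, two => two
  | two, one => two
  | two, two => two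

/-- Multiplication of `𝐁_H`. -/
def mul : H.AlgBH → H.AlgBH → H.AlgBH
  | zero, _ => zero
  | _, zero => zero
  | one, y => y
  | x, one => x
  | two, y => y
  | x, two => x
  | of s, of t => of (s.mul t)

/-- Exponentiation `x ↑ y` of `𝐁_H` (first argument the base). -/
def pow : H.AlgBH → H.AlgBH → H.AlgBH
  | _, zero => one
  | zero, _ => zero
  | one, _ => one
  | x, one => x
  | two, two => two
  | two, of _ => infty
  | of _, two => infty
  | of _, of _ => infty

/-- The operation `©` of `𝐁_H`: `x © y = x + y + 𝟏`, unless one of `x`, `y` is `𝟎`. -/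
noncomputable def binom : H.AlgBH → H.AlgBH → H.AlgBH
  | zero, _ => one
  | _, zero => one
  | x, y => add (add x y) one

/-- The operation `!` of `𝐁_H`: `x! = x²`, unless `x = 𝟎`. -/
def factorial : H.AlgBH → H.AlgBH
  | zero => one
  | x => mul x x

/-- The operation `exp₂` of `𝐁_H`: `exp₂ x = 𝟏 + x`. -/
noncomputable def exp2 (x : H.AlgBH) : H.AlgBH := add one x

/-- Interpretation of the operation symbols in `𝐁_H`. -/
noncomputable def interp : {n : ℕ} → CombOp n → (Fin n → H.AlgBH) → H.AlgBH
  | _, .zero, _ => zero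
  | _, .one, _ => one
  | _, .factorial, x => factorial (x 0)
  | _, .exp2, x => exp2 (x 0)
  | _, .add, x => add (x 0) (x 1)
  | _, .mul, x => mul (x 0) (x 1)
  | _, .pow, x => pow (x 0) (x 1)
  | _, .binom, x => binom (x 0) (x 1)

noncomputable instance instStructure (H : Hypergraph α) : combLang.Structure H.AlgBH where
  funMap := fun f x => interp f x
  RelMap := fun r _ => Empty.elim r

end AlgBH

end Hypergraph

/-! ## Short cycles -/

namespace Hypergraph

variable {α : Type*} {H : Hypergraph α}

/-! For the first claim, let `I` be the set of homomorphisms from `H` to the template, and send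
`𝐚_v` to the set of those with value `a` at `v`. The three sets of a hyperedge partition `I`, while
two vertices not in a common hyperedge have overlapping sets by robust satisfiability. So the
defining relations hold when sets are multiplied by disjoint union and overlapping sets have product
`∞`. Every element of `S_H` is `∞`, a generator, a product of two vertices of an edge, or the
product of a whole edge (`isNormal`); these go to `∞`, a set `homsAt v`, the complement of such a
set, and all of `I`. Robust satisfiability separates these values, so the representation is faithful
(`nonempty_setRep`). Now read a set `A` as the tuple in `𝐁^I` equal to `a` on `A` and `2` elsewhere.
Since `2·a = a`, `a·a = ∞` and `2 + a = ∞`, coordinatewise operations reproduce those of `𝐁_H`, once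
all tuples over `{2, a, ∞}` containing `∞` are identified. Thus `𝐁_H` is a quotient of a subalgebra
of a power of `𝐁` (`SetRep.inVarietyOf`). For the second claim, root each component of the forest.
Every edge has one parent, and every non-root is a child in exactly one edge, because in a
hyperforest removing an edge disconnects its points (`IsHyperforest.not_reachable`). A homomorphism
is then built downwards: root values are free, a parent with value `a` forces `1` on both children,
and a parent with value `1` leaves free which child gets `a` (`IsDepth.exists_extension`). Rooting
at `u` and steering the choices near `v` realises the prescribed values. -/

theorem girth_le_of_hasCycle {n : ℕ} (h : H.HasCycle n) : H.girth ≤ n :=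
  iInf₂_le n h

/-- Without cycles of length two, edges sharing two points agree. -/
theorem edge_eq_of_two_common (h2 : ¬ H.HasCycle 2) {e f : Set α} (he : e ∈ H.edgeSet)
    (hf : f ∈ H.edgeSet) {x y : α} (hxy : x ≠ y) (hxe : x ∈ e) (hye : y ∈ e) (hxf : x ∈ f)
    (hyf : y ∈ f) : e = f := by
  by_contra hef
  refine h2 ⟨le_rfl, ![x, y], ![e, f], ?_, ?_, ?_, ?_⟩
  · intro i j; fin_cases i <;> fin_cases j <;> simp [hxy, hxy.symm]
  · intro i j; fin_cases i <;> fin_cases j <;> simp [hef, Ne.symm hef]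
  · intro i; fin_cases i <;> simp [he, hf]
  · intro i j; fin_cases i <;> fin_cases j <;> simp [*]

/-- Without cycles of length two and three, pairwise adjacent points lie in a common edge. -/
theorem exists_edge_of_pairwise_adj (h3 : ¬ H.HasCycle 3) {x y z : α}
    (hxy : x ≠ y) (hyz : y ≠ z) (hxz : x ≠ z) (axy : H.Adj x y) (ayz : H.Adj y z)
    (axz : H.Adj x z) : ∃ e ∈ H.edgeSet, x ∈ e ∧ y ∈ e ∧ z ∈ e := by
  obtain ⟨e, he, hxe, hye⟩ := axy
  obtain ⟨f, hf, hyf, hzf⟩ := ayz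
  obtain ⟨g, hg, hxg, hzg⟩ := axz
  by_contra hno
  push Not at hno
  have hef : e ≠ f := fun h => hno e he hxe hye (h ▸ hzf)
  have heg : e ≠ g := fun h => hno e he hxe hye (h ▸ hzg)
  have hfg : f ≠ g := fun h => hno f hf (h ▸ hxg) hyf hzf
  refine h3 ⟨by norm_num, ![x, y, z], ![e, f, g], ?_, ?_, ?_, ?_⟩
  · intro i j; fin_cases i <;> fin_cases j <;> simp [hxy, hxy.symm, hyz, hyz.symm, hxz, hxz.symm]
  · intro i j; fin_cases i <;> fin_cases j <;> simp [hef, hef.symm, heg, heg.symm, hfg, hfg.symm]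
  · intro i; fin_cases i <;> simp [he, hf, hg]
  · intro i j; fin_cases i <;> fin_cases j <;> simp [*]

theorem IsTriple.ne (hH : H.IsThreeUniform) {u v w : H.vertexSet} (h : H.IsTriple u v w) :
    u ≠ v ∧ v ≠ w ∧ u ≠ w := by
  have hc := hH _ h
  refine ⟨?_, ?_, ?_⟩ <;> rintro rfl
  · rw [Set.insert_eq_of_mem (by simp)] at hc
    have := Set.ncard_insert_le (u : α) {(w : α)}
    simp at this; omega
  · rw [Set.pair_eq_singleton] at hc
    have := Set.ncard_insert_le (u : α) {(v : α)}
    simp at this; omega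
  · rw [Set.insert_eq_of_mem (by simp)] at hc
    have := Set.ncard_insert_le (v : α) {(u : α)}
    simp at this; omega

theorem isTriple_of_mem (hH : H.IsThreeUniform) {e : Set α} (he : e ∈ H.edgeSet)
    {u v w : H.vertexSet} (huv : u ≠ v) (hvw : v ≠ w) (huw : u ≠ w) (hu : (u : α) ∈ e)
    (hv : (v : α) ∈ e) (hw : (w : α) ∈ e) : H.IsTriple u v w := by
  have hc := hH e he
  have hfin : e.Finite := Set.finite_of_ncard_ne_zero (by omega)
  have : ({(u : α), (v : α), (w : α)} : Set α) = e := by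
    refine Set.eq_of_subset_of_ncard_le ?_ ?_ hfin
    · rintro x (rfl | rfl | rfl) <;> assumption
    · rw [hc, Set.ncard_eq_three.2]
      exact ⟨u, v, w, by simpa [Subtype.ext_iff] using huv, by simpa [Subtype.ext_iff] using huw,
        by simpa [Subtype.ext_iff] using hvw, rfl⟩
  unfold IsTriple
  rwa [this]

theorem IsPair.symm {u v : H.vertexSet} (h : H.IsPair u v) : H.IsPair v u :=
  ⟨h.1.symm, h.2.symm⟩

theorem IsPair.exists_isTriple (hH : H.IsThreeUniform) {u v : H.vertexSet} (h : H.IsPair u v) :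
    ∃ w, H.IsTriple u v w := by
  obtain ⟨huv, e, he, hu, hv⟩ := h
  obtain ⟨x, hx, hxu, hxv⟩ : ∃ x ∈ e, x ≠ u ∧ x ≠ v := by
    by_contra! hno
    have hsub : e ⊆ {(u : α), (v : α)} := fun x hx => by
      by_cases h : x = u
      · exact .inl h
      · exact .inr (hno x hx h)
    have h1 := Set.ncard_le_ncard hsub
    have h2 := Set.ncard_insert_le (u : α) {(v : α)}
    have h3 := hH e he
    simp at h2; omega
  refine ⟨⟨x, H.subset_vertexSet_of_mem_edgeSet' he hx⟩, isTriple_of_mem hH he huv ?_ ?_ hu hv hx⟩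
  · rintro rfl; exact hxv rfl
  · rintro rfl; exact hxu rfl

theorem isTriple_of_isPair (hH : H.IsThreeUniform) (h3 : ¬ H.HasCycle 3)
    {u v w : H.vertexSet} (huv : H.IsPair u v) (hvw : H.IsPair v w) (huw : H.IsPair u w) :
    H.IsTriple u v w := by
  obtain ⟨e, he, hu, hv, hw⟩ := exists_edge_of_pairwise_adj h3
    (Subtype.coe_injective.ne huv.1) (Subtype.coe_injective.ne hvw.1)
    (Subtype.coe_injective.ne huw.1) huv.2 hvw.2 huw.2
  exact isTriple_of_mem hH he huv.1 hvw.1 huw.1 hu hv hw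

/-! ## Normal forms in the hypergraph semiring -/

namespace HypSemiring

/-- The generator `𝐚_v`. -/
def gen (v : H.vertexSet) : H.HypSemiring := mk (H.letter v)

instance : Semigroup H.HypSemiring :=
  inferInstanceAs (Semigroup (conGen H.SemiringRel).Quotient)

theorem mk_mul (x y : H.Word) : (mk (x * y) : H.HypSemiring) = mk x * mk y := rfl

theorem mk_eq_of_rel {x y : H.Word} (h : H.SemiringRel x y) : (mk x : H.HypSemiring) = mk y :=
  (Con.eq _).2 (.of _ _ h)

theorem infty_mul_gen (v : H.vertexSet) : (infty : H.HypSemiring) * gen v = infty :=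
  mk_eq_of_rel (.infty_mul (some v))

theorem gen_mul_infty (v : H.vertexSet) : gen v * (infty : H.HypSemiring) = infty :=
  mk_eq_of_rel (.mul_infty (some v))

theorem infty_mul (s : H.HypSemiring) : infty * s = infty := by
  obtain ⟨w, rfl⟩ : ∃ w, s = mk w := by
    induction s using Quotient.inductionOn' with | h w => exact ⟨w, rfl⟩
  induction w using FreeSemigroup.recOnMul with
  | ih1 x => exact mk_eq_of_rel (.infty_mul x)
  | ih2 x y hx hy => rw [mk_mul, ← mul_assoc, hx, hy]

theorem gen_mul_comm (u v : H.vertexSet) : gen u * gen v = (gen v * gen u : H.HypSemiring) :=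
  mk_eq_of_rel (.comm u v)

theorem gen_mul_gen_of_not_isPair {u v : H.vertexSet} (h : ¬ H.IsPair u v) :
    gen u * gen v = (infty : H.HypSemiring) :=
  mk_eq_of_rel (.not_pair u v h)

theorem gen_mul_of_isTriple {u₁ v₁ w₁ u₂ v₂ w₂ : H.vertexSet} (h₁ : H.IsTriple u₁ v₁ w₁)
    (h₂ : H.IsTriple u₂ v₂ w₂) :
    gen u₁ * gen v₁ * gen w₁ = (gen u₂ * gen v₂ * gen w₂ : H.HypSemiring) :=
  mk_eq_of_rel (.triple _ _ _ _ _ _ h₁ h₂)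

theorem gen_mul_gen_of_isTriple {u₁ v₁ u₂ v₂ w : H.vertexSet} (h₁ : H.IsTriple u₁ v₁ w)
    (h₂ : H.IsTriple u₂ v₂ w) : gen u₁ * gen v₁ = (gen u₂ * gen v₂ : H.HypSemiring) :=
  mk_eq_of_rel (.pair _ _ _ _ _ h₁ h₂)

/-- Normal forms of elements of the hypergraph semiring. -/
inductive IsNormal : H.HypSemiring → Prop
  | infty : IsNormal infty
  | gen (v : H.vertexSet) : IsNormal (gen v)
  | pair {u v w : H.vertexSet} : H.IsTriple u v w → IsNormal (HypSemiring.gen u * HypSemiring.gen v)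
  | triple {u v w : H.vertexSet} : H.IsTriple u v w →
      IsNormal (HypSemiring.gen u * HypSemiring.gen v * HypSemiring.gen w)

theorem isNormal_gen_mul_gen (hH : H.IsThreeUniform) (u v : H.vertexSet) :
    IsNormal (gen u * gen v) := by
  by_cases h : H.IsPair u v
  · obtain ⟨w, hw⟩ := h.exists_isTriple hH
    exact .pair hw
  · rw [gen_mul_gen_of_not_isPair h]
    exact .infty

/-- Commutativity brings any two factors together, so a non-adjacent pair makes the product `∞`;
without 3-cycles, pairwise adjacent vertices fill an edge. -/
theorem gen_mul_gen_mul_gen (hH : H.IsThreeUniform) (h3 : ¬ H.HasCycle 3)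
    (u v w : H.vertexSet) : H.IsTriple u v w ∨ gen u * gen v * gen w = (infty : H.HypSemiring) := by
  by_cases huv : H.IsPair u v
  · by_cases hvw : H.IsPair v w
    · by_cases huw : H.IsPair u w
      · exact .inl (isTriple_of_isPair hH h3 huv hvw huw)
      · right
        rw [gen_mul_comm u v, mul_assoc, gen_mul_gen_of_not_isPair huw, gen_mul_infty]
    · right
      rw [mul_assoc, gen_mul_gen_of_not_isPair hvw, gen_mul_infty]
  · right
    rw [gen_mul_gen_of_not_isPair huv, infty_mul_gen]

theorem IsNormal.gen_mul (hH : H.IsThreeUniform) (h2 : ¬ H.HasCycle 2) (h3 : ¬ H.HasCycle 3)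
    (x : H.vertexSet) {s : H.HypSemiring} (hs : IsNormal s) : IsNormal (HypSemiring.gen x * s) := by
  cases hs with
  | infty => rw [gen_mul_infty]; exact .infty
  | gen v => exact isNormal_gen_mul_gen hH x v
  | @pair u v _ _ =>
    rw [← mul_assoc]
    rcases gen_mul_gen_mul_gen hH h3 x u v with h | h
    · exact .triple h
    · rw [h]; exact .infty
  | @triple u v w h =>
    rw [← mul_assoc, ← mul_assoc]
    rcases gen_mul_gen_mul_gen hH h3 x u v with h₁ | h₁
    · obtain ⟨hxu, huv, hxv⟩ := h₁.ne hH
      -- Both edges contain `u` and `v`, so they coincide and `x = w`. The product then contains the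
      -- square of a generator, which is `∞`.
      have he := edge_eq_of_two_common h2 h₁ h (Subtype.coe_injective.ne huv) (by simp) (by simp)
        (by simp) (by simp)
      have hx : (x : α) ∈ ({(u : α), (v : α), (w : α)} : Set α) := he ▸ by simp
      simp only [Set.mem_insert_iff, Set.mem_singleton_iff, Subtype.coe_inj] at hx
      obtain rfl : x = w := by tauto
      rw [gen_mul_comm x u, mul_assoc (HypSemiring.gen u), gen_mul_comm x v,
        ← mul_assoc, mul_assoc, gen_mul_gen_of_not_isPair (fun h => h.1 rfl), mul_assoc,
        gen_mul_infty, gen_mul_infty]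
      exact .infty
    · rw [h₁, infty_mul_gen]; exact .infty

theorem isNormal (hH : H.IsThreeUniform) (h2 : ¬ H.HasCycle 2) (h3 : ¬ H.HasCycle 3)
    (s : H.HypSemiring) : IsNormal s := by
  obtain ⟨w, rfl⟩ : ∃ w, s = mk w := by
    induction s using Quotient.inductionOn' with | h w => exact ⟨w, rfl⟩
  have hof (x : Option H.vertexSet) :
      (mk (FreeSemigroup.of x) : H.HypSemiring) = infty ∨
        ∃ v, (mk (FreeSemigroup.of x) : H.HypSemiring) = gen v := by
    cases x with
    | none => exact .inl rfl
    | some v => exact .inr ⟨v, rfl⟩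
  induction w using FreeSemigroup.recOnMul with
  | ih1 x =>
    rcases hof x with h | ⟨v, h⟩ <;> rw [h]
    exacts [.infty, .gen v]
  | ih2 x y _ hy =>
    rw [mk_mul]
    rcases hof x with h | ⟨v, h⟩ <;> rw [h]
    · rw [infty_mul]; exact .infty
    · exact hy.gen_mul hH h2 h3 v

end HypSemiring

end Hypergraph

/-! ## Representing the hypergraph semiring by partial disjoint unions -/

/-- Subsets of `I` together with an absorbing element `none`, multiplied by disjoint union where
possible, and with value `none` elsewhere. -/
inductive DisjUnion (I : Type*)
  | none
  | some (A : Set I)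

namespace DisjUnion

variable {I : Type*}

open Classical in
noncomputable instance : Mul (DisjUnion I) where
  mul
    | some A, some B => if Disjoint A B then some (A ∪ B) else none
    | _, _ => none

theorem none_mul (x : DisjUnion I) : none * x = none := by
  cases x <;> rfl

theorem mul_none (x : DisjUnion I) : x * none = none := by
  cases x <;> rfl

theorem some_mul_some_of_disjoint {A B : Set I} (h : Disjoint A B) :
    some A * some B = some (A ∪ B) :=
  if_pos h

theorem some_mul_some_of_not_disjoint {A B : Set I} (h : ¬ Disjoint A B) :
    some A * some B = none :=
  if_neg h

/-- Either bracketing gives the union if the three sets are pairwise disjoint, and `none` otherwise.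
-/
noncomputable instance : Semigroup (DisjUnion I) where
  mul_assoc x y z := by
    rcases x with _ | A
    · rw [none_mul, none_mul, none_mul]
    rcases y with _ | B
    · rw [mul_none, none_mul, mul_none]
    rcases z with _ | C
    · rw [mul_none, mul_none, mul_none]
    by_cases hAB : Disjoint A B <;> by_cases hBC : Disjoint B C
    · rw [some_mul_some_of_disjoint hAB, some_mul_some_of_disjoint hBC]
      by_cases hAC : Disjoint A C
      · rw [some_mul_some_of_disjoint (hAC.union_left hBC),
          some_mul_some_of_disjoint (hAB.union_right hAC), Set.union_assoc]
      · rw [some_mul_some_of_not_disjoint fun h => hAC (Set.disjoint_union_left.1 h).1,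
          some_mul_some_of_not_disjoint fun h => hAC (Set.disjoint_union_right.1 h).2]
    · rw [some_mul_some_of_disjoint hAB, some_mul_some_of_not_disjoint hBC, mul_none,
        some_mul_some_of_not_disjoint fun h => hBC (Set.disjoint_union_left.1 h).2]
    · rw [some_mul_some_of_not_disjoint hAB, some_mul_some_of_disjoint hBC, none_mul,
        some_mul_some_of_not_disjoint fun h => hAB (Set.disjoint_union_right.1 h).1]
    · rw [some_mul_some_of_not_disjoint hAB, some_mul_some_of_not_disjoint hBC, none_mul, mul_none]

end DisjUnion

theorem Tmpl.rel_iff {x y z : Tmpl} : (x, y, z) ∈ Tmpl.rel ↔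
    (x = a ∧ y = one ∧ z = one) ∨ (x = one ∧ y = a ∧ z = one) ∨ (x = one ∧ y = one ∧ z = a) := by
  simp [Tmpl.rel]

/-! ### Sets of homomorphisms as values of the generators. -/

namespace Hypergraph

variable {α : Type*} {H : Hypergraph α}

/-- Homomorphisms from `H` to the template. -/
abbrev TmplHom (H : Hypergraph α) := {φ : H.vertexSet → Tmpl // H.IsTmplHom φ}

/-- The homomorphisms taking the value `a` at `v`. -/
def homsAt (v : H.vertexSet) : Set H.TmplHom := {φ | φ.1 v = .a}

theorem IsRobustlySat.exists_hom (hR : H.IsRobustlySat) {u v : H.vertexSet} (huv : u ≠ v)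
    (p q : Tmpl) (h : ¬ (H.IsPair u v ∧ p = .a ∧ q = .a)) :
    ∃ φ : H.TmplHom, φ.1 u = p ∧ φ.1 v = q := by
  obtain ⟨φ, hφ, h⟩ := hR u v huv p q h
  exact ⟨⟨φ, hφ⟩, h⟩

/-- Robust satisfiability speaks only of two distinct vertices; a second vertex is needed to
prescribe the value at a single one. -/
theorem exists_ne_of_not_isIsolated (hH : H.IsThreeUniform)
    (hI : ∀ v ∈ H.vertexSet, ¬ H.IsIsolated v) (v : H.vertexSet) : ∃ u : H.vertexSet, u ≠ v := by
  have := hI v v.2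
  simp only [IsIsolated, not_forall, not_not] at this
  obtain ⟨e, he, hv⟩ := this
  obtain ⟨x, hx, hxv⟩ := Set.exists_ne_of_one_lt_ncard (by rw [hH e he]; norm_num) (v : α)
  exact ⟨⟨x, H.subset_vertexSet_of_mem_edgeSet' he hx⟩, fun h => hxv (by rw [← h])⟩

/-- Exactly one vertex of an edge takes the value `a`, so the three sets partition the
homomorphisms. -/
theorem IsTriple.disjoint_homsAt {u v w : H.vertexSet} (h : H.IsTriple u v w) :
    Disjoint (homsAt u) (homsAt v) ∧ homsAt u ∪ homsAt v = (homsAt w)ᶜ := by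
  constructor
  · rw [Set.disjoint_left]
    intro φ hu hv
    have := Tmpl.rel_iff.1 (φ.2 u v w h)
    simp only [homsAt, Set.mem_ofPred_eq] at hu hv
    simp [hu, hv] at this
  · ext φ
    have := Tmpl.rel_iff.1 (φ.2 u v w h)
    simp only [homsAt, Set.mem_union, Set.mem_compl_iff, Set.mem_ofPred_eq]
    rcases this with ⟨h1, h2, h3⟩ | ⟨h1, h2, h3⟩ | ⟨h1, h2, h3⟩ <;> simp [h1, h2, h3]

theorem homsAt_nonempty (hR : H.IsRobustlySat) (hne : ∀ v : H.vertexSet, ∃ u, u ≠ v)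
    (v : H.vertexSet) : (homsAt v).Nonempty := by
  obtain ⟨u, hu⟩ := hne v
  obtain ⟨φ, h, -⟩ := hR.exists_hom hu.symm .a .one (by simp)
  exact ⟨φ, h⟩

theorem not_disjoint_homsAt (hR : H.IsRobustlySat) (hne : ∀ v : H.vertexSet, ∃ u, u ≠ v)
    {u v : H.vertexSet} (h : ¬ H.IsPair u v) : ¬ Disjoint (homsAt u) (homsAt v) := by
  by_cases huv : u = v
  · subst huv
    rw [disjoint_self]
    exact (homsAt_nonempty hR hne u).ne_empty
  · obtain ⟨φ, h1, h2⟩ := hR.exists_hom huv .a .a (by simp [h])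
    exact Set.not_disjoint_iff.2 ⟨φ, h1, h2⟩

theorem nonempty_tmplHom (hR : H.IsRobustlySat) (hne : ∀ v : H.vertexSet, ∃ u, u ≠ v) :
    Nonempty H.TmplHom := by
  rcases isEmpty_or_nonempty H.vertexSet with h | ⟨⟨v⟩⟩
  · exact ⟨⟨fun _ => .a, fun u => (h.false u).elim⟩⟩
  · exact (homsAt_nonempty hR hne v).to_type

/-- The value of a letter in `DisjUnion`. -/
def letterVal : Option H.vertexSet → DisjUnion H.TmplHom
  | none => DisjUnion.none
  | some v => DisjUnion.some (homsAt v)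

/-- The value of a word in `DisjUnion`. -/
noncomputable def wordVal : H.Word →ₙ* DisjUnion H.TmplHom :=
  FreeSemigroup.lift letterVal

@[simp] theorem wordVal_of (x : Option H.vertexSet) :
    wordVal (FreeSemigroup.of x) = letterVal x := FreeSemigroup.lift_of _ _

theorem IsTriple.letterVal_mul {u v w : H.vertexSet} (h : H.IsTriple u v w) :
    letterVal (some u) * letterVal (some v) = DisjUnion.some (homsAt w)ᶜ := by
  rw [← h.disjoint_homsAt.2]
  exact DisjUnion.some_mul_some_of_disjoint h.disjoint_homsAt.1

theorem IsTriple.letterVal_mul_mul {u v w : H.vertexSet} (h : H.IsTriple u v w) :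
    letterVal (some u) * letterVal (some v) * letterVal (some w) =
      DisjUnion.some Set.univ := by
  rw [h.letterVal_mul, ← Set.compl_union_self (homsAt w)]
  exact DisjUnion.some_mul_some_of_disjoint disjoint_compl_left

theorem letterVal_mul_comm (u v : H.vertexSet) :
    letterVal (some u) * letterVal (some v) = letterVal (some v) * letterVal (some u) := by
  by_cases h : Disjoint (homsAt u) (homsAt v)
  · refine (DisjUnion.some_mul_some_of_disjoint h).trans ?_
    rw [Set.union_comm]
    exact (DisjUnion.some_mul_some_of_disjoint h.symm).symm
  · exact (DisjUnion.some_mul_some_of_not_disjoint h).trans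
      (DisjUnion.some_mul_some_of_not_disjoint fun h' => h h'.symm).symm

/-- Only `not_pair` needs robustness, to make the two sets overlap. The pair and triple relations
hold because the values are the complement of `homsAt w` and the whole set, whichever edge is used.
-/
theorem wordVal_eq_of_rel (hR : H.IsRobustlySat) (hne : ∀ v : H.vertexSet, ∃ u, u ≠ v)
    {x y : H.Word} (h : H.SemiringRel x y) : wordVal x = wordVal y := by
  induction h with
  | infty_mul x => simp only [inftyWord, map_mul, wordVal_of]; exact DisjUnion.none_mul _
  | mul_infty x => simp only [inftyWord, map_mul, wordVal_of]; exact DisjUnion.mul_none _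
  | comm u v => simp only [letter, map_mul, wordVal_of]; exact letterVal_mul_comm u v
  | not_pair u v h =>
    simp only [inftyWord, letter, map_mul, wordVal_of]
    exact DisjUnion.some_mul_some_of_not_disjoint (not_disjoint_homsAt hR hne h)
  | triple u₁ v₁ w₁ u₂ v₂ w₂ h₁ h₂ =>
    simp only [letter, map_mul, wordVal_of]
    rw [h₁.letterVal_mul_mul, h₂.letterVal_mul_mul]
  | pair u₁ v₁ u₂ v₂ w h₁ h₂ =>
    simp only [letter, map_mul, wordVal_of]
    rw [h₁.letterVal_mul, h₂.letterVal_mul]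

theorem wordVal_eq_of_conGen (hR : H.IsRobustlySat) (hne : ∀ v : H.vertexSet, ∃ u, u ≠ v)
    (x y : H.Word) (h : conGen H.SemiringRel x y) : wordVal x = wordVal y := by
  have : conGen H.SemiringRel ≤ Con.ker wordVal :=
    Con.conGen_le.2 fun x y h => wordVal_eq_of_rel hR hne h
  exact this h

/-- A faithful representation of the hypergraph semiring by partial disjoint unions of nonempty
sets. -/
structure SetRep (H : Hypergraph α) (I : Type*) where
  /-- The representing map. -/
  val : H.HypSemiring → DisjUnion I
  injective : Function.Injective val
  ne_empty : ∀ s, val s ≠ .some ∅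
  val_infty : val HypSemiring.infty = .none
  val_mul : ∀ s t : H.HypSemiring, val (s.mul t) = val s * val t

/-- Normal forms of different kinds have different values. Within a kind, the value determines the
vertex `v` of a generator or the missing vertex `w` of a pair, and the pair and triple relations
identify all normal forms that remain. -/
theorem nonempty_setRep (hH : H.IsThreeUniform) (h2 : ¬ H.HasCycle 2) (h3 : ¬ H.HasCycle 3)
    (hne : ∀ v : H.vertexSet, ∃ u, u ≠ v) (hR : H.IsRobustlySat) :
    Nonempty (SetRep H H.TmplHom) := by
  have hI := nonempty_tmplHom hR hne
  let val : H.HypSemiring → DisjUnion H.TmplHom :=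
    fun s => Con.liftOn (c := conGen H.SemiringRel) s wordVal (wordVal_eq_of_conGen hR hne)
  have val_mk (w : H.Word) : val (HypSemiring.mk w) = wordVal w := rfl
  have val_mul (s t : H.HypSemiring) : val (s * t) = val s * val t := by
    induction s using Quotient.inductionOn' with | h x => ?_
    induction t using Quotient.inductionOn' with | h y => ?_
    exact map_mul wordVal x y
  have val_infty : val HypSemiring.infty = DisjUnion.none := wordVal_of _
  have val_gen (v : H.vertexSet) :
      val (HypSemiring.gen v) = DisjUnion.some (homsAt v) := wordVal_of _
  have val_pair {u v w : H.vertexSet} (h : H.IsTriple u v w) :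
      val (HypSemiring.gen u * HypSemiring.gen v) =
        DisjUnion.some (homsAt w)ᶜ := by
    rw [val_mul, val_gen, val_gen]; exact h.letterVal_mul
  have val_triple {u v w : H.vertexSet} (h : H.IsTriple u v w) :
      val (HypSemiring.gen u * HypSemiring.gen v * HypSemiring.gen w) =
        DisjUnion.some Set.univ := by
    rw [val_mul, val_mul, val_gen, val_gen, val_gen]; exact h.letterVal_mul_mul
  -- Only the assignment `a, a` can be excluded, so with a value `1` adjacency does not matter.
  have sep {u v : H.vertexSet} (p q : Tmpl) (huv : u ≠ v) (hpq : p = .one ∨ q = .one) :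
      ∃ φ : H.TmplHom, φ.1 u = p ∧ φ.1 v = q :=
    hR.exists_hom huv p q (by rcases hpq with rfl | rfl <;> simp)
  have at_inj {u v : H.vertexSet} (h : homsAt u = homsAt v) : u = v := by
    by_contra huv
    obtain ⟨φ, hu, hv⟩ := sep .a .one huv (.inr rfl)
    have : φ ∈ homsAt v := h ▸ (hu : φ ∈ homsAt u)
    simp [homsAt, hv] at this
  have at_ne_compl (u v : H.vertexSet) : homsAt u ≠ (homsAt v)ᶜ := by
    intro h
    by_cases huv : u = v
    · subst huv
      exact ne_compl_self h
    · obtain ⟨φ, hu, hv⟩ := sep .one .one huv (.inr rfl)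
      have : φ ∈ homsAt u := h ▸ (by simp [homsAt, hv])
      simp [homsAt, hu] at this
  have at_ne_univ (v : H.vertexSet) : homsAt v ≠ Set.univ := by
    intro h
    obtain ⟨u, hu⟩ := hne v
    obtain ⟨φ, hu, hv⟩ := sep .one .one hu (.inr rfl)
    have : φ ∈ homsAt v := h ▸ Set.mem_univ _
    simp [homsAt, hv] at this
  have at_ne_empty (v : H.vertexSet) : homsAt v ≠ ∅ := (homsAt_nonempty hR hne v).ne_empty
  refine ⟨val, ?_, ?_, val_infty, val_mul⟩
  · intro s t hst
    cases HypSemiring.isNormal hH h2 h3 s with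
    | infty =>
      cases HypSemiring.isNormal hH h2 h3 t with
      | infty => rfl
      | gen v => rw [val_infty, val_gen] at hst; simp at hst
      | pair h => rw [val_infty, val_pair h] at hst; simp at hst
      | triple h => rw [val_infty, val_triple h] at hst; simp at hst
    | gen u =>
      cases HypSemiring.isNormal hH h2 h3 t with
      | infty => rw [val_infty, val_gen] at hst; simp at hst
      | gen v =>
        rw [val_gen, val_gen] at hst
        rw [at_inj (DisjUnion.some.inj hst)]
      | pair h =>
        rw [val_gen, val_pair h] at hst
        exact (at_ne_compl _ _ (DisjUnion.some.inj hst)).elim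
      | triple h =>
        rw [val_gen, val_triple h] at hst
        exact (at_ne_univ _ (DisjUnion.some.inj hst)).elim
    | pair h' =>
      cases HypSemiring.isNormal hH h2 h3 t with
      | infty => rw [val_infty, val_pair h'] at hst; simp at hst
      | gen v =>
        rw [val_gen, val_pair h'] at hst
        exact (at_ne_compl _ _ (DisjUnion.some.inj hst).symm).elim
      | pair h =>
        rw [val_pair h', val_pair h] at hst
        obtain rfl := at_inj (compl_injective (DisjUnion.some.inj hst))
        exact HypSemiring.gen_mul_gen_of_isTriple h' h
      | triple h =>
        rw [val_pair h', val_triple h] at hst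
        exact (at_ne_empty _ (Set.compl_univ_iff.1 (DisjUnion.some.inj hst))).elim
    | triple h' =>
      cases HypSemiring.isNormal hH h2 h3 t with
      | infty => rw [val_infty, val_triple h'] at hst; simp at hst
      | gen v =>
        rw [val_gen, val_triple h'] at hst
        exact (at_ne_univ _ (DisjUnion.some.inj hst).symm).elim
      | pair h =>
        rw [val_triple h', val_pair h] at hst
        exact (at_ne_empty _ (Set.compl_univ_iff.1 (DisjUnion.some.inj hst).symm)).elim
      | triple h => exact HypSemiring.gen_mul_of_isTriple h' h
  · intro s hs
    cases HypSemiring.isNormal hH h2 h3 s with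
    | infty => exact absurd (val_infty.symm.trans hs) (by simp)
    | gen v => exact at_ne_empty v (DisjUnion.some.inj ((val_gen v).symm.trans hs))
    | pair h =>
      exact at_ne_univ _ (Set.compl_empty_iff.1 (DisjUnion.some.inj ((val_pair h).symm.trans hs)))
    | triple h =>
      exact Set.univ_nonempty.ne_empty (DisjUnion.some.inj ((val_triple h).symm.trans hs))

/-! ## Equations of `𝐁` in the extended hypergraph algebra -/

/-- Either an element of `S_H` and the tuple over `{2, a}` that represents it, or `∞` and a tuple
over `{2, a, ∞}` in which `∞` occurs, or a constant. -/
inductive SetRep.Represents {I : Type*} (r : SetRep H I) : H.AlgBH → (I → AlgB) → Prop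
  | zero {c : I → AlgB} : (∀ i, c i = .zero) → r.Represents .zero c
  | one {c : I → AlgB} : (∀ i, c i = .one) → r.Represents .one c
  | two {c : I → AlgB} : (∀ i, c i = .two) → r.Represents .two c
  | infty {c : I → AlgB} : (∀ i, c i = .two ∨ c i = .a ∨ c i = .infty) → (∃ i, c i = .infty) →
      r.Represents (.of .infty) c
  | of {c : I → AlgB} {s : H.HypSemiring} {A : Set I} : r.val s = .some A →
      (∀ i ∈ A, c i = .a) → (∀ i ∉ A, c i = .two) → r.Represents (.of s) c

namespace SetRep

variable {I : Type*} {r : SetRep H I}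

theorem nonempty_of_val {s : H.HypSemiring} {A : Set I} (h : r.val s = .some A) : A.Nonempty :=
  Set.nonempty_iff_ne_empty.2 fun hA => r.ne_empty s (hA ▸ h)

theorem exists_represents [Nonempty I] (r : SetRep H I) (b : H.AlgBH) :
    ∃ c, r.Represents b c := by
  classical
  cases b with
  | zero => exact ⟨_, .zero fun _ => rfl⟩
  | one => exact ⟨_, .one fun _ => rfl⟩
  | two => exact ⟨_, .two fun _ => rfl⟩
  | of s =>
    cases h : r.val s with
    | none =>
      obtain rfl := r.injective (h.trans r.val_infty.symm)
      exact ⟨fun _ => .infty, .infty (by simp) (by simp)⟩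
    | some A =>
      exact ⟨fun i => if i ∈ A then .a else .two, .of h (by simp +contextual) (by simp +contextual)⟩

/-- The representing sets are nonempty, so their tuples have a coordinate `a` and differ from the
constant tuple `2`. Faithfulness of `r` separates the elements of `S_H`. -/
theorem Represents.eq [Nonempty I] {b b' : H.AlgBH} {c : I → AlgB} (h : r.Represents b c)
    (h' : r.Represents b' c) : b = b' := by
  obtain ⟨i₀⟩ := ‹Nonempty I›
  cases h with
  | zero h =>
    cases h' with
    | zero h' => rfl
    | one h' => simp_all
    | two h' => simp_all
    | infty h' _ => simp_all
    | @of _ _ A hA h1 h2 => by_cases hi : i₀ ∈ A <;> grind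
  | one h =>
    cases h' with
    | zero h' => simp_all
    | one h' => rfl
    | two h' => simp_all
    | infty h' _ => simp_all
    | @of _ _ A hA h1 h2 => by_cases hi : i₀ ∈ A <;> grind
  | two h =>
    cases h' with
    | zero h' => simp_all
    | one h' => simp_all
    | two h' => rfl
    | infty h' _ => simp_all
    | of hA h1 h2 =>
      obtain ⟨i, hi⟩ := nonempty_of_val hA
      simp_all
  | infty h hi =>
    cases h' with
    | zero h' => simp_all
    | one h' => simp_all
    | two h' => simp_all
    | infty h' _ => rfl
    | of hA h1 h2 => grind
  | @of _ _ B hB h3 h4 =>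
    cases h' with
    | zero h' => by_cases hi : i₀ ∈ B <;> grind
    | one h' => by_cases hi : i₀ ∈ B <;> grind
    | two h' =>
      obtain ⟨i, hi⟩ := nonempty_of_val hB
      simp_all
    | infty h' _ => grind
    | @of _ t A hA h1 h2 =>
      congr 1
      refine r.injective (hB.trans (Eq.trans ?_ hA.symm))
      congr 1
      ext i
      by_cases h1 : i ∈ A <;> grind

/-! ### Compatibility of the representation with the operations. -/

variable {b b' : H.AlgBH} {c c' : I → AlgB}

theorem represents_zero_iff : r.Represents .zero c ↔ ∀ i, c i = .zero :=
  ⟨fun | .zero h => h, .zero⟩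

theorem represents_one_iff : r.Represents .one c ↔ ∀ i, c i = .one :=
  ⟨fun | .one h => h, .one⟩

theorem represents_two_iff : r.Represents .two c ↔ ∀ i, c i = .two :=
  ⟨fun | .two h => h, .two⟩

theorem Represents.of_cases {s : H.HypSemiring} (h : r.Represents (.of s) c) (i : I) :
    c i = .two ∨ c i = .a ∨ c i = .infty := by
  cases h with
  | infty h _ => exact h i
  | @of _ _ A hA h1 h2 => by_cases hi : i ∈ A <;> simp [*]

theorem Represents.exists_ne_two {s : H.HypSemiring} (h : r.Represents (.of s) c) :
    ∃ i, c i = .a ∨ c i = .infty := by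
  cases h with
  | infty _ h => exact h.imp fun i hi => .inr hi
  | of hA h1 _ => exact (nonempty_of_val hA).imp fun i hi => .inl (h1 i hi)

/-- Disjoint sets meet only in products `a·2` and `2·2`; a common point gives the coordinate `a·a =
∞`. -/
theorem Represents.mul_of {s t : H.HypSemiring} (h : r.Represents (.of s) c)
    (h' : r.Represents (.of t) c') : r.Represents (.of (s.mul t)) fun i => (c i).mul (c' i) := by
  have hcases (i : I) : (c i).mul (c' i) = .two ∨ (c i).mul (c' i) = .a ∨
      (c i).mul (c' i) = .infty := by
    rcases h.of_cases i with e | e | e <;> rcases h'.of_cases i with e' | e' | e' <;>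
      simp [e, e', AlgB.mul]
  have hnone (hv : r.val (s.mul t) = .none) : s.mul t = HypSemiring.infty :=
    r.injective (hv.trans r.val_infty.symm)
  have hv := r.val_mul s t
  cases h with
  | infty _ hi =>
    rw [hnone (by rw [hv, r.val_infty, DisjUnion.none_mul])]
    refine .infty hcases (hi.imp fun i e => ?_)
    rcases h'.of_cases i with e' | e' | e' <;> simp [e, e', AlgB.mul]
  | @of _ _ A hA h1 h2 =>
    have h := Represents.of hA h1 h2
    cases h' with
    | infty _ hi =>
      rw [hnone (by rw [hv, r.val_infty, DisjUnion.mul_none])]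
      refine .infty hcases (hi.imp fun i e => ?_)
      rcases h.of_cases i with e' | e' | e' <;> simp [e, e', AlgB.mul]
    | @of _ _ B hB h3 h4 =>
      rw [hA, hB] at hv
      by_cases hAB : Disjoint A B
      · rw [DisjUnion.some_mul_some_of_disjoint hAB] at hv
        refine .of hv ?_ ?_
        · rintro i (hi | hi)
          · simp [h1 i hi, h4 i (hAB.notMem_of_mem_left hi), AlgB.mul]
          · simp [h3 i hi, h2 i (hAB.notMem_of_mem_right hi), AlgB.mul]
        · intro i hi
          simp only [Set.mem_union, not_or] at hi
          simp [h2 i hi.1, h4 i hi.2, AlgB.mul]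
      · rw [DisjUnion.some_mul_some_of_not_disjoint hAB] at hv
        obtain ⟨i, hi, hi'⟩ := Set.not_disjoint_iff.1 hAB
        rw [hnone hv]
        exact .infty hcases ⟨i, by simp [h1 i hi, h3 i hi', AlgB.mul]⟩

/-- Distinct elements have distinct sets, and a point in just one of them gives the coordinate `a +
2 = ∞`. -/
theorem Represents.add_of {s t : H.HypSemiring} (h : r.Represents (.of s) c)
    (h' : r.Represents (.of t) c') : r.Represents (.of (s.add t)) fun i => (c i).add (c' i) := by
  have hcases (i : I) : (c i).add (c' i) = .two ∨ (c i).add (c' i) = .a ∨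
      (c i).add (c' i) = .infty := by
    rcases h.of_cases i with e | e | e <;> rcases h'.of_cases i with e' | e' | e' <;>
      simp [e, e', AlgB.add]
  cases h with
  | infty _ hi =>
    have : HypSemiring.infty.add t = (HypSemiring.infty : H.HypSemiring) := by
      simp [HypSemiring.add]
    rw [this]
    refine .infty hcases (hi.imp fun i e => ?_)
    rcases h'.of_cases i with e' | e' | e' <;> simp [e, e', AlgB.add]
  | @of _ _ A hA h1 h2 =>
    have h := Represents.of hA h1 h2
    cases h' with
    | infty _ hi =>
      have : s.add HypSemiring.infty = (HypSemiring.infty : H.HypSemiring) := by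
        simp +contextual [HypSemiring.add]
      rw [this]
      refine .infty hcases (hi.imp fun i e => ?_)
      rcases h.of_cases i with e' | e' | e' <;> simp [e, e', AlgB.add]
    | @of _ _ B hB h3 h4 =>
      by_cases hst : s = t
      · subst hst
        obtain rfl : A = B := DisjUnion.some.inj (hA.symm.trans hB)
        rw [HypSemiring.add, if_pos rfl]
        exact .of hA (fun i hi => by simp [h1 i hi, h3 i hi, AlgB.add])
          fun i hi => by simp [h2 i hi, h4 i hi, AlgB.add]
      · rw [HypSemiring.add, if_neg hst]
        refine .infty hcases ?_
        have hAB : A ≠ B := by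
          rintro rfl
          exact hst (r.injective (hA.trans hB.symm))
        by_contra! hno
        refine hAB (Set.ext fun i => ?_)
        have := hno i
        by_cases hi : i ∈ A <;> by_cases hi' : i ∈ B <;> simp_all [AlgB.add]

theorem Represents.add (h : r.Represents b c) (h' : r.Represents b' c') :
    r.Represents (b.add b') fun i => (c i).add (c' i) := by
  rcases b with _ | _ | _ | s <;> rcases b' with _ | _ | _ | t
  case of.of => exact h.add_of h'
  case one.of | two.of =>
    refine .infty (fun i => ?_) (h'.exists_ne_two.imp fun i e => ?_)
    · rcases h'.of_cases i with e | e | e <;>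
        simp_all [represents_one_iff, represents_two_iff, AlgB.add]
    · rcases e with e | e <;> simp_all [represents_one_iff, represents_two_iff, AlgB.add]
  case of.one | of.two =>
    refine .infty (fun i => ?_) (h.exists_ne_two.imp fun i e => ?_)
    · rcases h.of_cases i with e | e | e <;>
        simp_all [represents_one_iff, represents_two_iff, AlgB.add]
    · rcases e with e | e <;> simp_all [represents_one_iff, represents_two_iff, AlgB.add]
  case zero.of =>
    have : (fun i => (c i).add (c' i)) = c' := funext fun i => by
      rw [represents_zero_iff.1 h i]; rfl
    rw [this]
    exact h'
  case of.zero =>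
    have : (fun i => (c i).add (c' i)) = c := by
      funext i
      rw [represents_zero_iff.1 h' i]
      cases c i <;> rfl
    rw [this]
    exact h
  all_goals
    simp only [AlgBH.add, represents_zero_iff, represents_one_iff, represents_two_iff] at h h' ⊢
    simp [h, h', AlgB.add]

theorem Represents.mul (h : r.Represents b c) (h' : r.Represents b' c') :
    r.Represents (b.mul b') fun i => (c i).mul (c' i) := by
  rcases b with _ | _ | _ | s <;> rcases b' with _ | _ | _ | t
  case of.of => exact h.mul_of h'
  case one.of | two.of =>
    have : (fun i => (c i).mul (c' i)) = c' := by
      funext i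
      rcases h'.of_cases i with e | e | e <;>
        simp_all [represents_one_iff, represents_two_iff, AlgB.mul]
    rw [this]
    exact h'
  case of.one | of.two =>
    have : (fun i => (c i).mul (c' i)) = c := by
      funext i
      rcases h.of_cases i with e | e | e <;>
        simp_all [represents_one_iff, represents_two_iff, AlgB.mul]
    rw [this]
    exact h
  case of.zero =>
    refine .zero fun i => ?_
    rcases h.of_cases i with e | e | e <;> simp [represents_zero_iff.1 h' i, e, AlgB.mul]
  case zero.of => exact .zero fun i => by simp [represents_zero_iff.1 h i, AlgB.mul]
  all_goals
    simp only [AlgBH.mul, represents_zero_iff, represents_one_iff, represents_two_iff] at h h' ⊢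
    simp [h, h', AlgB.mul]

theorem Represents.pow (h : r.Represents b c) (h' : r.Represents b' c') :
    r.Represents (b.pow b') fun i => (c i).pow (c' i) := by
  rcases b with _ | _ | _ | s <;> rcases b' with _ | _ | _ | t
  case of.of =>
    have hcases (i : I) : (c i).pow (c' i) = .two ∨ (c i).pow (c' i) = .infty := by
      rcases h.of_cases i with e | e | e <;> rcases h'.of_cases i with e' | e' | e' <;>
        simp [e, e', AlgB.pow]
    -- A base `a` or `∞` yields `∞` with each of the exponents `2`, `a`, `∞`, so a coordinate where
    -- the base is not `2` suffices.
    refine .infty (fun i => (hcases i).imp_right .inr) (h.exists_ne_two.imp fun i e => ?_)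
    rcases e with e | e <;> rcases h'.of_cases i with e' | e' | e' <;> simp [e, e', AlgB.pow]
  case two.of =>
    refine .infty (fun i => ?_) (h'.exists_ne_two.imp fun i e => ?_)
    · rcases h'.of_cases i with e | e | e <;> simp [represents_two_iff.1 h i, e, AlgB.pow]
    · rcases e with e | e <;> simp [represents_two_iff.1 h i, e, AlgB.pow]
  case of.two =>
    refine .infty (fun i => ?_) (h.exists_ne_two.imp fun i e => ?_)
    · rcases h.of_cases i with e | e | e <;> simp [represents_two_iff.1 h' i, e, AlgB.pow]
    · rcases e with e | e <;> simp [represents_two_iff.1 h' i, e, AlgB.pow]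
  case zero.of =>
    refine .zero fun i => ?_
    rcases h'.of_cases i with e | e | e <;> simp [represents_zero_iff.1 h i, e, AlgB.pow]
  case one.of =>
    refine .one fun i => ?_
    rcases h'.of_cases i with e | e | e <;> simp [represents_one_iff.1 h i, e, AlgB.pow]
  case of.zero => exact .one fun i => by simp [represents_zero_iff.1 h' i, AlgB.pow]
  case of.one =>
    have : (fun i => (c i).pow (c' i)) = c := by
      funext i
      rcases h.of_cases i with e | e | e <;> simp [represents_one_iff.1 h' i, e, AlgB.pow]
    rw [this]
    exact h
  all_goals
    simp only [AlgBH.pow, represents_zero_iff, represents_one_iff, represents_two_iff] at h h' ⊢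
    simp [h, h', AlgB.pow]

theorem Represents.factorial (h : r.Represents b c) :
    r.Represents b.factorial fun i => (c i).factorial := by
  have hsq (x : AlgB) (hx : x ≠ .zero) : x.factorial = x.mul x := by
    cases x <;> first | rfl | exact absurd rfl hx
  rcases b with _ | _ | _ | s
  case zero => exact .one fun i => by simp [represents_zero_iff.1 h i, AlgB.factorial]
  case one => exact .one fun i => by simp [represents_one_iff.1 h i, AlgB.factorial]
  case two => exact .two fun i => by simp [represents_two_iff.1 h i, AlgB.factorial]
  case of =>
    have : (fun i => (c i).factorial) = fun i => (c i).mul (c i) := by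
      funext i
      refine hsq _ ?_
      rcases h.of_cases i with e | e | e <;> simp [e]
    rw [this]
    exact h.mul h

theorem Represents.exp2 (h : r.Represents b c) : r.Represents b.exp2 fun i => (c i).exp2 := by
  have hadd (x : AlgB) : x.exp2 = AlgB.one.add x := by cases x <;> rfl
  simp only [hadd]
  exact (Represents.one fun _ => rfl).add h

theorem Represents.binom (h : r.Represents b c) (h' : r.Represents b' c') :
    r.Represents (b.binom b') fun i => (c i).binom (c' i) := by
  have hadd (x y : AlgB) (hx : x ≠ .zero) (hy : y ≠ .zero) :
      x.binom y = (x.add y).add .one := by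
    cases x <;> cases y <;> first | rfl | exact absurd rfl hx | exact absurd rfl hy
  have hne {b : H.AlgBH} {c : I → AlgB} (h : r.Represents b c) (hb : b ≠ .zero) (i : I) :
      c i ≠ .zero := by
    rcases b with _ | _ | _ | s
    · exact absurd rfl hb
    · simp [represents_one_iff.1 h i]
    · simp [represents_two_iff.1 h i]
    · rcases h.of_cases i with e | e | e <;> simp [e]
  by_cases hb : b = .zero
  · subst hb
    exact .one fun i => by simp [represents_zero_iff.1 h i, AlgB.binom]
  by_cases hb' : b' = .zero
  · subst hb'
    have : b.binom .zero = .one := by cases b <;> rfl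
    rw [this]
    refine .one fun i => ?_
    rw [represents_zero_iff.1 h' i]
    cases c i <;> rfl
  have : b.binom b' = (b.add b').add .one := by
    cases b <;> cases b' <;> first | rfl | exact absurd rfl hb | exact absurd rfl hb'
  rw [this]
  have : (fun i => (c i).binom (c' i)) = fun i => ((c i).add (c' i)).add .one :=
    funext fun i => hadd _ _ (hne h hb i) (hne h' hb' i)
  rw [this]
  exact (h.add h').add (.one fun _ => rfl)

/-- The relation `Represents` is a subalgebra of `𝐁_H × 𝐁^I`, hence closed under term operations. -/
theorem Represents.realize {y : ℕ → H.AlgBH} {x : I → ℕ → AlgB}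
    (h : ∀ n, r.Represents (y n) fun i => x i n) (t : combLang.Term ℕ) :
    r.Represents (t.realize y) fun i => t.realize (x i) := by
  induction t with
  | var n => exact h n
  | func f ts ih =>
    cases f with
    | zero => exact .zero fun _ => rfl
    | one => exact .one fun _ => rfl
    | factorial => exact (ih 0).factorial
    | exp2 => exact (ih 0).exp2
    | add => exact (ih 0).add (ih 1)
    | mul => exact (ih 0).mul (ih 1)
    | pow => exact (ih 0).pow (ih 1)
    | binom => exact (ih 0).binom (ih 1)

theorem inVarietyOf [Nonempty I] (r : SetRep H I) : InVarietyOf combLang AlgB H.AlgBH := by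
  intro s t hst y
  choose c hc using fun n => r.exists_represents (y n)
  have hs := Represents.realize (x := fun i n => c n i) hc s
  have ht := Represents.realize (x := fun i n => c n i) hc t
  simp only [hst] at hs
  exact hs.eq ht

end SetRep

/-- The extended hypergraph algebra of a robustly satisfiable hypergraph lies in the variety
of `𝐁`. -/
theorem inVarietyOf_algBH (hH : H.IsThreeUniform) (h2 : ¬ H.HasCycle 2) (h3 : ¬ H.HasCycle 3)
    (hI : ∀ v ∈ H.vertexSet, ¬ H.IsIsolated v) (hR : H.IsRobustlySat) :
    InVarietyOf combLang AlgB H.AlgBH := by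
  have hne := exists_ne_of_not_isIsolated hH hI
  have := nonempty_tmplHom hR hne
  obtain ⟨r⟩ := nonempty_setRep hH h2 h3 hne hR
  exact r.inVarietyOf

end Hypergraph

/-! ## Hyperforests -/

/-- The graph in which distinct points are adjacent if some member of `E` contains both. -/
def familyGraph {α : Type*} (E : Set (Set α)) : SimpleGraph α where
  Adj x y := x ≠ y ∧ ∃ e ∈ E, x ∈ e ∧ y ∈ e
  symm := ⟨fun _ _ ⟨hne, e, he, hx, hy⟩ => ⟨hne.symm, e, he, hy, hx⟩⟩
  loopless := ⟨fun _ h => h.1 rfl⟩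

/-- The two pieces of a geodesic bound the distances to its ends from above, and the triangle
inequality forces equality. -/
theorem SimpleGraph.Walk.dist_getVert {V : Type*} {G : SimpleGraph V} {u v : V} (p : G.Walk u v)
    (hp : p.length = G.dist u v) {i : ℕ} (hi : i ≤ p.length) : G.dist u (p.getVert i) = i := by
  have h1 : G.dist u (p.getVert i) ≤ i := by
    refine (SimpleGraph.dist_le (p.take i)).trans ?_
    simp
  have h2 : G.dist (p.getVert i) v ≤ p.length - i := by
    refine (SimpleGraph.dist_le (p.drop i)).trans ?_
    simp
  have h3 := (p.take i).reachable.dist_triangle_left v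
  omega

namespace Hypergraph

variable {α : Type*} {H : Hypergraph α}

theorem IsHyperforest.not_hasCycle (h : H.IsHyperforest) (n : ℕ) : ¬ H.HasCycle n := fun hc => by
  have := girth_le_of_hasCycle hc
  rw [h] at this
  simp at this

/-- A shortest path between two points of an edge `e` that avoids `e` closes up to a cycle. -/
theorem IsHyperforest.not_reachable (h : H.IsHyperforest) {e : Set α} (he : e ∈ H.edgeSet)
    {x y : α} (hxy : x ≠ y) (hx : x ∈ e) (hy : y ∈ e) :
    ¬ (familyGraph (H.edgeSet \ {e})).Reachable x y := by
  intro hr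
  obtain ⟨p, hp⟩ := hr.exists_walk_length_eq_dist
  have hpos : 0 < p.length := hp ▸ hr.pos_dist_of_ne hxy
  have hadj (i : ℕ) (hi : i < p.length) := (p.adj_getVert_succ hi).2
  choose f hf hf1 hf2 using hadj
  have hdist {i : ℕ} (hi : i ≤ p.length) := p.dist_getVert hp hi
  -- A repeated edge would make vertices `i` and `j + 1` adjacent, although their distances from `x`
  -- differ by at least two.
  have hlt {i j : ℕ} (hi : i < p.length) (hj : j < p.length) (hij : i < j) : f i hi ≠ f j hj := by
    intro heq
    have h1 : (familyGraph (H.edgeSet \ {e})).Adj (p.getVert i) (p.getVert (j + 1)) := by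
      refine ⟨fun h => ?_, f i hi, hf i hi, hf1 i hi, heq ▸ hf2 j hj⟩
      have := hdist hi.le
      rw [h, hdist hj] at this
      omega
    have h2 := h1.reachable.dist_triangle_right x
    rw [hdist hi.le, hdist (Nat.succ_le_of_lt hj), SimpleGraph.dist_eq_one_iff_adj.2 h1] at h2
    omega
  -- The path has `p.length + 1` vertices; the edge at the last index is `e`, which leads back from
  -- `y` to `x`.
  refine h.not_hasCycle (p.length + 1) ⟨by omega, fun i => p.getVert i,
    fun i => if hi : (i : ℕ) < p.length then f i hi else e, ?_, ?_, ?_, ?_⟩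
  · intro i j hij
    have := hdist (Nat.le_of_lt_succ i.2)
    simp only at hij
    rw [hij, hdist (Nat.le_of_lt_succ j.2)] at this
    exact Fin.ext this.symm
  · intro i j hij
    simp only at hij
    by_cases hi : (i : ℕ) < p.length <;> by_cases hj : (j : ℕ) < p.length
    · rw [dif_pos hi, dif_pos hj] at hij
      rcases lt_trichotomy (i : ℕ) j with hl | hl | hl
      · exact (hlt hi hj hl hij).elim
      · exact Fin.ext hl
      · exact (hlt hj hi hl hij.symm).elim
    · rw [dif_pos hi, dif_neg hj] at hij
      exact ((hf i hi).2 hij).elim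
    · rw [dif_neg hi, dif_pos hj] at hij
      exact ((hf j hj).2 hij.symm).elim
    · exact Fin.ext (by omega)
  · intro i
    simp only
    split_ifs with hi
    · exact (hf i hi).1
    · exact he
  · intro i j hij
    simp only
    split_ifs with hi
    · rw [Nat.mod_eq_of_lt (by omega)] at hij
      rw [hij]
      exact ⟨hf1 i hi, hf2 i hi⟩
    · have hi' : (i : ℕ) = p.length := by omega
      rw [hi', Nat.mod_self] at hij
      rw [hi', hij]
      simpa using ⟨hy, hx⟩

/-- Depth functions that exhibit a hypergraph as a rooted forest: every edge has a unique point of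
least depth, and every point of positive depth lies above a unique edge. -/
structure IsDepth (H : Hypergraph α) (d : α → ℕ) : Prop where
  exists_parent : ∀ e ∈ H.edgeSet, e.Nonempty → ∃ w ∈ e, ∀ z ∈ e, z ≠ w → d z = d w + 1
  exists_edge : ∀ x, 0 < d x → ∃ e ∈ H.edgeSet, x ∈ e ∧ ∃ w ∈ e, d w < d x
  edge_unique : ∀ e ∈ H.edgeSet, ∀ f ∈ H.edgeSet, ∀ x ∈ e, x ∈ f → (∃ w ∈ e, d w < d x) →
    (∃ w ∈ f, d w < d x) → e = f

/-! ### Depth as distance to a root. -/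

theorem reachable_of_mem {e : Set α} (he : e ∈ H.edgeSet) {x y : α} (hx : x ∈ e) (hy : y ∈ e) :
    (familyGraph H.edgeSet).Reachable x y := by
  by_cases hxy : x = y
  · rw [hxy]
  · exact SimpleGraph.Adj.reachable ⟨hxy, e, he, hx, hy⟩

theorem exists_edge_dist_lt {x y : α} (h : (familyGraph H.edgeSet).Reachable x y) (hxy : x ≠ y) :
    ∃ e ∈ H.edgeSet, ∃ z, x ∈ e ∧ z ∈ e ∧
      (familyGraph H.edgeSet).dist z y < (familyGraph H.edgeSet).dist x y := by
  obtain ⟨p, hp⟩ := h.exists_walk_length_eq_dist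
  cases p with
  | nil => exact (hxy rfl).elim
  | @cons _ z _ hadj q =>
    rw [SimpleGraph.Walk.length_cons] at hp
    have := SimpleGraph.dist_le q
    obtain ⟨-, e, he, hx, hz⟩ := hadj
    exact ⟨e, he, z, hx, hz, by omega⟩

/-- A geodesic from `x` to its root immediately gets strictly closer to the root than every point of
`e`, so none of its edges is `e`. -/
theorem reachable_root_of_forall_le {root : α → α}
    (hroot : ∀ x, (familyGraph H.edgeSet).Reachable x (root x))
    (hconst : ∀ x y, (familyGraph H.edgeSet).Reachable x y → root x = root y) {e : Set α} {x : α}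
    (h : ∀ z ∈ e, (familyGraph H.edgeSet).dist x (root x) ≤
      (familyGraph H.edgeSet).dist z (root z)) :
    (familyGraph (H.edgeSet \ {e})).Reachable x (root x) := by
  induction hn : (familyGraph H.edgeSet).dist x (root x) using Nat.strong_induction_on
    generalizing x with
  | _ n ih =>
    by_cases hx : x = root x
    · rw [← hx]
    obtain ⟨f, hf, y, hxf, hyf, hlt⟩ := exists_edge_dist_lt (hroot x) hx
    have hxy := hconst x y (reachable_of_mem hf hxf hyf)
    rw [hxy] at hlt hn h
    rw [hxy]
    have hfe : f ≠ e := by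
      rintro rfl
      exact absurd (h y hyf) (by omega)
    have hadj : (familyGraph (H.edgeSet \ {e})).Adj x y := by
      refine ⟨?_, f, ⟨hf, hfe⟩, hxf, hyf⟩
      rintro rfl
      exact lt_irrefl _ hlt
    exact hadj.reachable.trans (ih _ (hn ▸ hlt) (fun z hz => hlt.le.trans (h z hz)) rfl)

theorem IsHyperforest.isDepth_dist (hF : H.IsHyperforest) {root : α → α}
    (hroot : ∀ x, (familyGraph H.edgeSet).Reachable x (root x))
    (hconst : ∀ x y, (familyGraph H.edgeSet).Reachable x y → root x = root y) :
    H.IsDepth fun x => (familyGraph H.edgeSet).dist x (root x) := by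
  have hle {e : Set α} (he : e ∈ H.edgeSet) {x y : α} (hx : x ∈ e) (hy : y ∈ e) :
      (familyGraph H.edgeSet).dist y (root y) ≤ (familyGraph H.edgeSet).dist x (root x) + 1 := by
    by_cases hxy : x = y
    · rw [hxy]; omega
    have hr := reachable_of_mem he hy hx
    have h1 := hr.dist_triangle_left (root x)
    have h2 : (familyGraph H.edgeSet).dist y x = 1 :=
      SimpleGraph.dist_eq_one_iff_adj.2 ⟨Ne.symm hxy, e, he, hy, hx⟩
    rw [hconst y x hr]
    omega
  refine ⟨?_, ?_, ?_⟩
  · intro e he hne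
    obtain ⟨w, hw, hmin⟩ : ∃ w ∈ e, ∀ z ∈ e, (familyGraph H.edgeSet).dist w (root w) ≤
        (familyGraph H.edgeSet).dist z (root z) := by
      obtain ⟨w, hw, hmin⟩ := WellFounded.has_min
        (measure fun x => (familyGraph H.edgeSet).dist x (root x)).wf e hne
      exact ⟨w, hw, fun z hz => not_lt.1 (hmin z hz)⟩
    -- A second point of least depth would also reach the root without `e`, joining two points of
    -- `e` outside `e`.
    refine ⟨w, hw, fun z hz hzw => le_antisymm (hle he hw hz) (Nat.succ_le_of_lt ?_)⟩
    refine (hmin z hz).lt_of_ne fun heq => hF.not_reachable he hzw hz hw ?_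
    have h1 := reachable_root_of_forall_le hroot hconst hmin
    have h2 := reachable_root_of_forall_le hroot hconst (fun y hy => heq ▸ hmin y hy)
    rw [hconst z w (reachable_of_mem he hz hw)] at h2
    exact h2.trans h1.symm
  · intro x hx
    have hne : x ≠ root x := by
      intro h
      rw [← h, SimpleGraph.dist_self] at hx
      exact lt_irrefl _ hx
    obtain ⟨e, he, y, hxe, hye, hlt⟩ := exists_edge_dist_lt (hroot x) hne
    refine ⟨e, he, hxe, y, hye, ?_⟩
    rwa [← hconst x y (reachable_of_mem he hxe hye)]
  · rintro e he f hf x hxe hxf ⟨w, hwe, hw⟩ ⟨y, hyf, hy⟩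
    by_contra hef
    -- Depths within `e` differ by at most one, so `w` and `y`, both above `x`, are no deeper than
    -- any point of `e`. Both reach the root without `e`, and `f` joins `x` to `y`.
    have h1 := reachable_root_of_forall_le hroot hconst (e := e) (x := w) fun z hz => by
      have := hle he hz hxe
      omega
    have h2 := reachable_root_of_forall_le hroot hconst (e := e) (x := y) fun z hz => by
      have := hle he hz hxe
      omega
    have h3 : (familyGraph (H.edgeSet \ {e})).Reachable x y := by
      refine SimpleGraph.Adj.reachable ⟨?_, f, ⟨hf, Ne.symm hef⟩, hxf, hyf⟩
      rintro rfl
      exact lt_irrefl _ hy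
    have hwx : w ≠ x := by
      rintro rfl
      exact lt_irrefl _ hw
    rw [hconst y x (reachable_of_mem hf hyf hxf)] at h2
    rw [hconst w x (reachable_of_mem he hwe hxe)] at h1
    exact hF.not_reachable he hwx hwe hxe (h1.trans (h3.trans h2).symm)

/-- A hyperforest has a depth function for which `u` is a root, and so is `v` unless it lies in the
component of `u`. -/
theorem IsHyperforest.exists_isDepth (hF : H.IsHyperforest) (u v : α) :
    ∃ d, H.IsDepth d ∧ d u = 0 ∧
      (d v = 0 ∨ ∀ e ∈ H.edgeSet, v ∈ e → ∀ w ∈ e, d w = 0 → w = u) := by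
  classical
  let G := familyGraph H.edgeSet
  -- The component of `u` is rooted at `u`, that of `v` at `v` if it is a different one, and all
  -- others arbitrarily.
  let root (x : α) : α :=
    if G.Reachable x u then u else if G.Reachable x v then v else (G.connectedComponentMk x).out
  have hroot (x : α) : G.Reachable x (root x) := by
    simp only [root]
    split_ifs with h1 h2
    · exact h1
    · exact h2
    · exact (SimpleGraph.ConnectedComponent.exact (Quot.out_eq (G.connectedComponentMk x))).symm
  have hconst (x y : α) (h : G.Reachable x y) : root x = root y := by
    have h1 (z : α) : G.Reachable x z ↔ G.Reachable y z := ⟨h.symm.trans, h.trans⟩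
    simp only [root, h1, SimpleGraph.ConnectedComponent.sound h]
  have hu {x : α} (h : G.Reachable x u) : root x = u := if_pos h
  refine ⟨_, hF.isDepth_dist hroot hconst, ?_, ?_⟩
  · simp only [hu (SimpleGraph.Reachable.refl u)]
    exact SimpleGraph.dist_self
  · by_cases hvu : G.Reachable v u
    · refine .inr fun e he hve w hwe hw => ?_
      have hwu : G.Reachable w u := (reachable_of_mem he hwe hve).trans hvu
      simp only [hu hwu] at hw
      exact hwu.dist_eq_zero_iff.1 hw
    · left
      have : root v = v := by
        simp only [root, if_neg hvu]
        exact if_pos (SimpleGraph.Reachable.refl v)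
      simp only [this]
      exact SimpleGraph.dist_self

/-- Along a rooted forest, values at the roots and a choice `ch e` of a child for each edge `e`
extend to a map that takes the value `a` at `ch e` if it does not at the parent, and is `1` at
every other child. -/
theorem IsDepth.exists_extension {d : α → ℕ} (hd : H.IsDepth d) {par : Set α → α}
    (hpar : ∀ e ∈ H.edgeSet, par e ∈ e ∧ ∀ z ∈ e, z ≠ par e → d z = d (par e) + 1)
    (ρ : α → Tmpl) (ch : Set α → α) :
    ∃ φ : α → Tmpl, (∀ x, d x = 0 → φ x = ρ x) ∧
      ∀ e ∈ H.edgeSet, ∀ x ∈ e, x ≠ par e →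
        (φ (par e) = .a → φ x = .one) ∧
        (φ (par e) = .one → ch e = x → φ x = .a) ∧ (ch e ≠ x → φ x = .one) := by
  classical
  let IsChild (x : α) (e : Set α) : Prop := e ∈ H.edgeSet ∧ x ∈ e ∧ x ≠ par e
  have huniq {x : α} {e f : Set α} (he : IsChild x e) (hf : IsChild x f) : e = f := by
    have key {g : Set α} (hg : IsChild x g) : ∃ w ∈ g, d w < d x :=
      ⟨par g, (hpar g hg.1).1, by rw [(hpar g hg.1).2 x hg.2.1 hg.2.2]; omega⟩
    exact hd.edge_unique e he.1 f hf.1 x he.2.1 hf.2.1 (key he) (key hf)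
  let step (g : α → Tmpl) (x : α) : Tmpl :=
    if h : ∃ e, IsChild x e then
      if g (par h.choose) = .one ∧ ch h.choose = x then .a else .one
    else .one
  let it (n : ℕ) : α → Tmpl := step^[n] ρ
  -- The number of rounds must equal the depth: `step` resets roots to `1`, so a root is read after
  -- zero rounds and each child one round after its parent.
  refine ⟨fun x => it (d x) x, fun x hx => by simp only [hx]; rfl, fun e he x hx hxe => ?_⟩
  have hval : it (d x) x =
      if it (d (par e)) (par e) = Tmpl.one ∧ ch e = x then .a else .one := by
    have h : ∃ e, IsChild x e := ⟨e, he, hx, hxe⟩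
    rw [(hpar e he).2 x hx hxe]
    simp only [it, Function.iterate_succ_apply']
    simp only [step, dif_pos h]
    rw [huniq h.choose_spec ⟨he, hx, hxe⟩]
  simp only [hval]
  refine ⟨fun h => ?_, fun h h' => ?_, fun h => ?_⟩ <;> simp [h]
  exact h'

theorem mem_rel_of_child {x y z p c : α} {φ : α → Tmpl} (hxy : x ≠ y) (hyz : y ≠ z) (hxz : x ≠ z)
    (hp : p = x ∨ p = y ∨ p = z) (hc : c = x ∨ c = y ∨ c = z) (hcp : c ≠ p)
    (h : ∀ t, (t = x ∨ t = y ∨ t = z) → t ≠ p → (φ p = .a → φ t = .one) ∧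
        (φ p = .one → c = t → φ t = .a) ∧ (c ≠ t → φ t = .one)) :
    (φ x, φ y, φ z) ∈ Tmpl.rel := by
  rw [Tmpl.rel_iff]
  have hx := h x (by simp)
  have hy := h y (by simp)
  have hz := h z (by simp)
  cases hφ : φ p <;> rcases hp with rfl | rfl | rfl <;> rcases hc with rfl | rfl | rfl <;>
    grind

/-- Hyperforests are robustly satisfiable. -/
theorem IsHyperforest.isRobustlySat (hH : H.IsThreeUniform) (hF : H.IsHyperforest) :
    H.IsRobustlySat := by
  intro u v huv p q hpq
  have huv' : (u : α) ≠ v := Subtype.coe_injective.ne huv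
  obtain ⟨d, hd, hdu, hdv⟩ := hF.exists_isDepth u v
  have hexists (e : Set α) (he : e ∈ H.edgeSet) (s t : α) : ∃ c ∈ e, c ≠ s ∧ c ≠ t := by
    by_contra! hno
    have hsub : e ⊆ {s, t} := fun c hc => by
      by_cases h : c = s
      · exact .inl h
      · exact .inr (hno c hc h)
    have h1 := Set.ncard_le_ncard hsub
    have h2 := Set.ncard_insert_le s {t}
    have h3 := hH e he
    simp at h2; omega
  have hpar (e : Set α) : ∃ w, e ∈ H.edgeSet → w ∈ e ∧ ∀ z ∈ e, z ≠ w → d z = d w + 1 := by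
    by_cases he : e ∈ H.edgeSet
    · obtain ⟨c, hc, -⟩ := hexists e he u u
      obtain ⟨w, hw, h⟩ := hd.exists_parent e he ⟨c, hc⟩
      exact ⟨w, fun _ => ⟨hw, h⟩⟩
    · exact ⟨u, fun h => (he h).elim⟩
  choose par hpar using hpar
  have hchild (x : α) (hx : 0 < d x) : ∃ e ∈ H.edgeSet, x ∈ e ∧ x ≠ par e := by
    obtain ⟨e, he, hxe, w, hwe, hw⟩ := hd.exists_edge x hx
    refine ⟨e, he, hxe, fun h => ?_⟩
    by_cases hwp : w = par e
    · rw [hwp, ← h] at hw; omega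
    · have := (hpar e he).2 w hwe hwp
      rw [← h] at this; omega
  classical
  -- `Good` is the constraint on which child of each edge may be chosen to carry `a`.
  have key (Good : Set α → α → Prop)
      (hGood : ∀ e ∈ H.edgeSet, ∃ c ∈ e, c ≠ par e ∧ Good e c) :
      ∃ (φ : α → Tmpl) (ch : Set α → α), H.IsTmplHom (fun x => φ x) ∧ φ u = p ∧
        (d v = 0 → φ v = q) ∧ (∀ e ∈ H.edgeSet, Good e (ch e)) ∧
        ∀ e ∈ H.edgeSet, ∀ x ∈ e, x ≠ par e →
          (φ (par e) = .a → φ x = .one) ∧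
          (φ (par e) = .one → ch e = x → φ x = .a) ∧ (ch e ≠ x → φ x = .one) := by
    have hGood' (e : Set α) : ∃ c, e ∈ H.edgeSet → c ∈ e ∧ c ≠ par e ∧ Good e c := by
      by_cases he : e ∈ H.edgeSet
      · obtain ⟨c, h⟩ := hGood e he
        exact ⟨c, fun _ => h⟩
      · exact ⟨u, fun h => (he h).elim⟩
    choose ch hch using hGood'
    obtain ⟨φ, h0, h⟩ := hd.exists_extension hpar (fun x => if x = v then q else p) ch
    refine ⟨φ, ch, ?_, ?_, ?_, fun e he => (hch e he).2.2, h⟩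
    · intro x y z hxyz
      obtain ⟨hxy, hyz, hxz⟩ := hxyz.ne hH
      exact mem_rel_of_child (Subtype.coe_injective.ne hxy) (Subtype.coe_injective.ne hyz)
        (Subtype.coe_injective.ne hxz) (hpar _ hxyz).1 (hch _ hxyz).1 (hch _ hxyz).2.1 (h _ hxyz)
    · rw [h0 u hdu, if_neg huv']
    · intro hv
      rw [h0 v hv, if_pos rfl]
  -- If `v` is itself a root, its value is free and any choice of children will do.
  rcases Nat.eq_zero_or_pos (d v) with hv | hv
  · obtain ⟨φ, -, hom, hu, hv', -⟩ := key (fun _ _ => True) fun e he => by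
      obtain ⟨c, hc, h, -⟩ := hexists e he (par e) (par e)
      exact ⟨c, hc, h, trivial⟩
    exact ⟨_, hom, hu, hv' hv⟩
  obtain ⟨e, he, hve, hvp⟩ := hchild v hv
  cases q with
  | one =>
    -- A child that is never chosen has value `1`.
    obtain ⟨φ, ch, hom, hu, -, hGood, h⟩ := key (fun _ c => c ≠ v) fun e he => hexists e he _ _
    exact ⟨_, hom, hu, (h e he v hve hvp).2.2 (hGood e he)⟩
  | a =>
    -- For `v` to get `a` it must be chosen in `e` and its parent must have value `1`; the latter is
    -- arranged by never choosing `par e` in any edge.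
    obtain ⟨φ, ch, hom, hu, -, hGood, h⟩ :=
      key (fun f c => (f = e → c = v) ∧ c ≠ par e) fun f hf => by
        by_cases hfe : f = e
        · subst hfe
          exact ⟨v, hve, hvp, fun _ => rfl, hvp⟩
        · obtain ⟨c, hc, h1, h2⟩ := hexists f hf (par f) (par e)
          exact ⟨c, hc, h1, fun h => (hfe h).elim, h2⟩
    refine ⟨_, hom, hu, (h e he v hve hvp).2.1 ?_ ((hGood e he).1 rfl)⟩
    -- If the parent is a root, it is `u`. Then `u` and `v` share the edge `e`, so the excluded case
    -- gives `p = 1`.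
    rcases Nat.eq_zero_or_pos (d (par e)) with hw | hw
    · have hwu : par e = u := by
        rcases hdv with hdv | hdv
        · omega
        · exact hdv e he hve _ (hpar e he).1 hw
      have hp : p ≠ .a := fun hp =>
        hpq ⟨⟨huv, e, he, hwu ▸ (hpar e he).1, hve⟩, hp, rfl⟩
      rw [hwu, hu]
      cases p
      · exact (hp rfl).elim
      · rfl
    · obtain ⟨f, hf, hwf, hwp⟩ := hchild _ hw
      exact (h f hf _ hwf hwp).2.2 (hGood f hf).2

end Hypergraph

theorem lemma3p7 {α : Type*} (H : Hypergraph α) (h3 : H.IsThreeUniform) :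
    (5 ≤ H.girth → (∀ v ∈ H.vertexSet, ¬ H.IsIsolated v) → H.IsRobustlySat →
      InVarietyOf combLang AlgB H.AlgBH) ∧
    (H.IsHyperforest → H.IsRobustlySat) := by
  refine ⟨fun hg hI hR => ?_, fun hF => hF.isRobustlySat h3⟩
  have hno (n : ℕ) (hn : n < 5) : ¬ H.HasCycle n := fun hc => by
    have := hg.trans (Hypergraph.girth_le_of_hasCycle hc)
    exact absurd (Nat.cast_le.1 this) (not_le.2 hn)
  exact Hypergraph.inVarietyOf_algBH h3 (hno 2 (by norm_num)) (hno 3 (by norm_num)) hI hR
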